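/- A partial multi-valued function $P:\subseteq\mathbb{N}^{\mathbb{N}}\rightrightarrows\mathbb{N}^{\mathbb{N}}$ is given by its graph; its domain is the set of all $x$ with $P(x)\neq\emptyset$. A choice function of $P$ is a partial function $g$ on $\mathbb{N}^{\mathbb{N}}$ with $\operatorname{dom}(g)\supseteq\operatorname{dom}(P)$ and $g(x)\in P(x)$ for all $x\in\operatorname{dom}(P)$. Write $P\leq_W^c Q$ if there are partial functions $H,K:\subseteq\mathbb{N}^{\mathbb{N}}\to\mathbb{N}^{\mathbb{N}}$, continuous on their domains, such that for every choice function $g$ of $Q$ the partial function $x\mapsto H(\langle x,g(K(x))\rangle)$ is a choice function of $P$. Let $\mathfrak{C}_0$ be the set of equivalence classes (degrees) of partial multi-valued functions under the preorder $\leq_W^c$, with an additional top element $\top$ adjoined, and let $\mathfrak{C}$ be $\mathfrak{C}_0$ without the degree $\bot$ of the multi-valued function with empty domain. Both are bounded lattices; the supremum of the degrees of $P$ and $Q$ is the degree of $P\coprod Q$, where $(P\coprod Q)(0p)=0P(p)$ and $(P\coprod Q)(1p)=1Q(p)$, and their infimum is the degree of $P\oplus Q$, where $(P\oplus Q)(\langle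 p,q\rangle)=0P(p)\cup 1Q(q)$ for $p\in\operatorname{dom}(P)$, $q\in\operatorname{dom}(Q)$. A bounded lattice $(\mathfrak{L},\wedge,\vee)$ is a Brouwer algebra if for all $\mathbf{a},\mathbf{b}\in\mathfrak{L}$ the set $\{\mathbf{c}\in\mathfrak{L}\mid\mathbf{b}\leq\mathbf{c}\vee\mathbf{a}\}$ contains a smallest element. For $n>1$, $\mathrm{LLPO}_{n,1}$ has as domain the set of all $\langle p_1,p_2,\ldots\rangle$ with at most one pair $(i,j)$ such that $p_i(j)\neq 0$, and its values there are the sequences $i0^{\mathbb{N}}$ with $1\leq i\leq n$ and $p_i=0^{\mathbb{N}}$. $\mathrm{LLPO}_{\infty,2}$ has as domain the set of all $\langle p_1,p_2,\ldots\rangle$ with at most two pairs $(i,j)$ such that $p_i(j)\neq 0$, and its values there are the sequences $i0^{\mathbb{N}}$ with $i\geq 1$ and $p_i=0^{\mathbb{N}}$. For $k>1$, $\Sigma_k^\infty\mathrm{LLPO}$ is defined by $\Sigma_k^\infty\mathrm{LLPO}(\langle 0^{\mathbb{N}},p\rangle)=\mathrm{LLPO}_{\infty,2}(p)$ and $\Sigma_k^\infty\mathrm{LLPO}(\langle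 0^n10^{\mathbb{N}},p\rangle)=\mathrm{LLPO}_{n,1}(p)$ for $n\geq k$. Theorem. Neither $\mathfrak{C}_0$ nor $\mathfrak{C}$ is a Brouwer algebra. Moreover, neither the set of all $R\in\mathfrak{C}_0$ with $\Sigma_2^\infty\mathrm{LLPO}\leq_W^c R\coprod\mathrm{LLPO}_{2,1}$ nor the set of all $R\in\mathfrak{C}$ with this property has a minimal element; and $\Sigma_{k+1}^\infty\mathrm{LLPO}<_W^c\Sigma_k^\infty\mathrm{LLPO}$ for all $k>1$. -/

import Mathlib

namespace ContWeihrauch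

/-! ## Baire space, pairing, and partial continuous functions -/

/-- Baire space `ℕ^ℕ`, with the product topology of the discrete spaces `ℕ`. -/
abbrev Baire : Type := ℕ → ℕ

/-- The sequence `n p`, i.e. `p` preceded by the symbol `n`. -/
def cons (n : ℕ) (p : Baire) : Baire
  | 0 => n
  | m + 1 => p m

/-- The shift, sending `n p` to `p`. -/
def tail (p : Baire) : Baire := fun m => p (m + 1)

/-- The standard pairing `⟨p, q⟩ = p(0) q(0) p(1) q(1) …`. -/
def pair (p q : Baire) : Baire := fun n => if n % 2 = 0 then p (n / 2) else q (n / 2)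

/-- First projection of the pairing. -/
def left (x : Baire) : Baire := fun n => x (2 * n)

/-- Second projection of the pairing. -/
def right (x : Baire) : Baire := fun n => x (2 * n + 1)

/-- A partial function on Baire space is continuous if it is continuous on its domain, which
carries the subspace topology. -/
def PartialContinuous (f : Baire →. Baire) : Prop := Continuous f.asSubtype

/-! ## Multi-valued functions and continuous Weihrauch reducibility -/

/-- A partial multi-valued function on Baire space, given by its graph: `P.values x` is the set of
values at `x`, and it is empty exactly when `x` is outside of the domain. -/
structure MultiFun where
  values : Baire → Set Baire

namespace MultiFun

/-- The domain of a partial multi-valued function. -/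
def dom (P : MultiFun) : Set Baire := {x | (P.values x).Nonempty}

/-- `g` is a choice function of `P`: `dom g ⊇ dom P` and `g x ∈ P x` for all `x ∈ dom P`. -/
def IsChoice (P : MultiFun) (g : Baire →. Baire) : Prop :=
  ∀ x ∈ P.dom, ∃ y ∈ g x, y ∈ P.values x

end MultiFun

/-- The partial function `H⟨id, g K⟩`. -/
def sandwich (H K g : Baire →. Baire) : Baire →. Baire := fun x =>
  (K x).bind fun q => (g q).bind fun r => H (pair x r)

/-- Continuous Weihrauch reducibility `P ≤_W^c Q`. -/
def WeihrauchLE (P Q : MultiFun) : Prop :=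
  ∃ H K : Baire →. Baire, PartialContinuous H ∧ PartialContinuous K ∧
    ∀ g : Baire →. Baire, Q.IsChoice g → P.IsChoice (sandwich H K g)

/-! ### Elementary facts -/

@[simp] theorem cons_zero (n : ℕ) (p : Baire) : cons n p 0 = n := rfl
@[simp] theorem tail_cons (n : ℕ) (p : Baire) : tail (cons n p) = p := rfl

theorem cons_tail (p : Baire) : cons (p 0) (tail p) = p := by
  funext m; cases m <;> rfl

@[simp] theorem left_pair (p q : Baire) : left (pair p q) = p := by
  funext n; simp [left, pair]

@[simp] theorem right_pair (p q : Baire) : right (pair p q) = q := by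
  funext n
  have h1 : (2 * n + 1) % 2 ≠ 0 := by omega
  have h2 : (2 * n + 1) / 2 = n := by omega
  simp [right, pair, h2]

theorem continuous_tail : Continuous tail :=
  continuous_pi fun m => continuous_apply (m + 1)

theorem continuous_cons (n : ℕ) : Continuous (cons n) :=
  continuous_pi fun m => by
    cases m with
    | zero => exact continuous_const
    | succ m => exact continuous_apply m

theorem continuous_left : Continuous left :=
  continuous_pi fun n => continuous_apply (2 * n)

theorem continuous_right : Continuous right :=
  continuous_pi fun n => continuous_apply (2 * n + 1)

theorem continuous_pair : Continuous fun z : Baire × Baire => pair z.1 z.2 :=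
  continuous_pi fun n => by
    by_cases h : n % 2 = 0
    · simp only [pair, h, if_true]
      exact (continuous_apply (n / 2)).comp continuous_fst
    · simp only [pair, h, if_false]
      exact (continuous_apply (n / 2)).comp continuous_snd

theorem partialContinuous_res {f : Baire → Baire} {s : Set Baire} (h : ContinuousOn f s) :
    PartialContinuous (PFun.res f s) := by
  exact continuousOn_iff_continuous_domRestrict.1 h

open Classical in
theorem PartialContinuous.exists_total {f : Baire →. Baire} (h : PartialContinuous f) :
    ∃ F : Baire → Baire, ContinuousOn F f.Dom ∧ ∀ x y, y ∈ f x → F x = y := by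
  refine ⟨fun x => if hx : (f x).Dom then (f x).get hx else 0, ?_, ?_⟩
  · rw [continuousOn_iff_continuous_domRestrict]
    have he : f.Dom.domRestrict (fun x => if hx : (f x).Dom then (f x).get hx else 0) =
        f.asSubtype := by
      funext x
      have hx : (f x.1).Dom := x.2
      simp only [Set.domRestrict_apply, dif_pos hx]
      rfl
    rw [he]
    exact h
  · rintro x y ⟨hx, rfl⟩
    simp only [dif_pos hx]

open Classical in
/-- A pointwise reformulation of the reducibility, with total functions that are continuous on the
relevant sets. -/
theorem weihrauchLE_iff {P Q : MultiFun} : WeihrauchLE P Q ↔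
    ∃ (K : Baire → Baire) (H : Baire × Baire → Baire), ContinuousOn K P.dom ∧
      ContinuousOn H {z | z.1 ∈ P.dom ∧ z.2 ∈ Q.values (K z.1)} ∧
      ∀ p ∈ P.dom, K p ∈ Q.dom ∧ ∀ r ∈ Q.values (K p), H (p, r) ∈ P.values p := by
  constructor
  · rintro ⟨H, K, hH, hK, h⟩
    have key : ∀ p ∈ P.dom, ∃ q ∈ K p, q ∈ Q.dom ∧
        ∀ r ∈ Q.values q, ∃ s ∈ H (pair p r), s ∈ P.values p := by
      intro p hp
      have step : ∀ c : Baire → Baire, (∀ x ∈ Q.dom, c x ∈ Q.values x) →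
          ∃ q ∈ K p, q ∈ Q.dom ∧ ∃ s ∈ H (pair p (c q)), s ∈ P.values p := by
        intro c hc
        obtain ⟨s, hs, hsP⟩ := h (PFun.res c Q.dom)
          (fun x hx => ⟨c x, (PFun.mem_res _ _ _ _).2 ⟨hx, rfl⟩, hc x hx⟩) p hp
        simp only [sandwich, Part.mem_bind_iff] at hs
        obtain ⟨q, hq, r, hr, hs⟩ := hs
        obtain ⟨hqQ, rfl⟩ := (PFun.mem_res _ _ _ _).1 hr
        exact ⟨q, hq, hqQ, s, hs, hsP⟩
      let c : Baire → Baire := fun x => if hx : x ∈ Q.dom then hx.choose else 0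
      have hc : ∀ x ∈ Q.dom, c x ∈ Q.values x := by
        intro x hx
        simp only [c, dif_pos hx]
        exact hx.choose_spec
      obtain ⟨q, hq, hqQ, -⟩ := step c hc
      refine ⟨q, hq, hqQ, fun r hr => ?_⟩
      obtain ⟨q', hq', -, s, hs, hsP⟩ := step (Function.update c q r) (by
        intro x hx
        by_cases hxq : x = q
        · subst hxq; simpa using hr
        · simpa [hxq] using hc x hx)
      obtain rfl := Part.mem_unique hq hq'
      exact ⟨s, by simpa using hs, hsP⟩
    obtain ⟨FK, hFK, hFK'⟩ := hK.exists_total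
    obtain ⟨FH, hFH, hFH'⟩ := hH.exists_total
    refine ⟨FK, fun z => FH (pair z.1 z.2), ?_, ?_, ?_⟩
    · refine hFK.mono fun p hp => ?_
      obtain ⟨q, hq, -⟩ := key p hp
      exact (PFun.mem_dom _ _).2 ⟨q, hq⟩
    · refine hFH.comp continuous_pair.continuousOn ?_
      rintro ⟨p, r⟩ ⟨hp, hr⟩
      obtain ⟨q, hq, -, hqr⟩ := key p hp
      simp only [hFK' p q hq] at hr
      obtain ⟨s, hs, -⟩ := hqr r hr
      exact (PFun.mem_dom _ _).2 ⟨s, hs⟩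
    · intro p hp
      obtain ⟨q, hq, hqQ, hqr⟩ := key p hp
      rw [hFK' p q hq]
      refine ⟨hqQ, fun r hr => ?_⟩
      obtain ⟨s, hs, hsP⟩ := hqr r hr
      simpa only [hFH' _ s hs] using hsP
  · rintro ⟨K, H, hK, hH, h⟩
    refine ⟨PFun.res (fun x => H (left x, right x))
        {x | left x ∈ P.dom ∧ right x ∈ Q.values (K (left x))}, PFun.res K P.dom,
      partialContinuous_res ?_, partialContinuous_res hK, ?_⟩
    · exact hH.comp (continuous_left.prodMk continuous_right).continuousOn fun x hx => hx
    · intro g hg p hp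
      obtain ⟨hKp, hr⟩ := h p hp
      obtain ⟨r, hrg, hrQ⟩ := hg _ hKp
      refine ⟨H (p, r), ?_, hr r hrQ⟩
      simp only [sandwich, Part.mem_bind_iff, PFun.mem_res]
      exact ⟨K p, ⟨hp, rfl⟩, r, hrg, by simpa using ⟨hp, hrQ⟩, by simp⟩

instance : Preorder MultiFun where
  le := WeihrauchLE
  le_refl P := weihrauchLE_iff.2
    ⟨id, Prod.snd, continuousOn_id, continuous_snd.continuousOn, fun p hp => ⟨hp, fun _ hr => hr⟩⟩
  le_trans P Q R hPQ hQR := by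
    obtain ⟨K, H, hK, hH, h⟩ := weihrauchLE_iff.1 hPQ
    obtain ⟨K', H', hK', hH', h'⟩ := weihrauchLE_iff.1 hQR
    refine weihrauchLE_iff.2 ⟨K' ∘ K, fun z => H (z.1, H' (K z.1, z.2)), ?_, ?_, ?_⟩
    · exact hK'.comp hK fun p hp => (h p hp).1
    · have hA : ContinuousOn (fun z : Baire × Baire => (K z.1, z.2))
          {z | z.1 ∈ P.dom ∧ z.2 ∈ R.values ((K' ∘ K) z.1)} :=
        (hK.comp continuousOn_fst fun z hz => hz.1).prodMk continuousOn_snd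
      have hB := hH'.comp hA fun z hz => ⟨(h _ hz.1).1, hz.2⟩
      exact hH.comp (continuousOn_fst.prodMk hB) fun z hz =>
        ⟨hz.1, (h' _ (h _ hz.1).1).2 _ hz.2⟩
    · intro p hp
      have h1 := h p hp
      exact ⟨(h' _ h1.1).1, fun r hr => h1.2 _ ((h' _ h1.1).2 r hr)⟩

theorem le_def {P Q : MultiFun} : P ≤ Q ↔ WeihrauchLE P Q := Iff.rfl

/-! ## The operations `∐` and `⊕` and the bottom element -/

namespace MultiFun

/-- The coproduct: `(P ∐ Q)(0p) = 0P(p)` and `(P ∐ Q)(1p) = 1Q(p)`. -/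
def coprod (P Q : MultiFun) : MultiFun where
  values x := {y | (x 0 = 0 ∧ ∃ z ∈ P.values (tail x), y = cons 0 z) ∨
    (x 0 = 1 ∧ ∃ z ∈ Q.values (tail x), y = cons 1 z)}

/-- The infimum: `(P ⊕ Q)(⟨p, q⟩) = 0P(p) ∪ 1Q(q)` for `p ∈ dom P` and `q ∈ dom Q`. -/
def oplus (P Q : MultiFun) : MultiFun where
  values x := {y | left x ∈ P.dom ∧ right x ∈ Q.dom ∧
    ((∃ z ∈ P.values (left x), y = cons 0 z) ∨ (∃ z ∈ Q.values (right x), y = cons 1 z))}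

/-- The multi-valued function with empty domain. -/
def empty : MultiFun := ⟨fun _ => ∅⟩

/-- The identity on Baire space. -/
def ident : MultiFun := ⟨fun x => {x}⟩

end MultiFun

theorem continuousOn_ite_of_eq {X Y : Type*} [TopologicalSpace X] [TopologicalSpace Y]
    {s : Set X} {c : X → ℕ} (hc : Continuous c) (n : ℕ) {f g : X → Y}
    (hf : ContinuousOn f {x | x ∈ s ∧ c x = n}) (hg : ContinuousOn g {x | x ∈ s ∧ c x ≠ n}) :
    ContinuousOn (fun x => if c x = n then f x else g x) s := by
  intro x hx
  by_cases h : c x = n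
  · have hU : {y | c y = n} ∈ nhds x := by
      have : {m : ℕ | m = n} ∈ nhds (c x) := by simp [h]
      exact hc.continuousAt.preimage_mem_nhds this
    have h1 := hf x ⟨hx, h⟩
    have h2 : ContinuousWithinAt f s x := by
      rw [← continuousWithinAt_inter hU]
      exact h1
    refine h2.congr_of_eventuallyEq ?_ (by simp [h])
    filter_upwards [mem_nhdsWithin_of_mem_nhds hU] with y hy
    exact if_pos hy
  · have hU : {y | c y ≠ n} ∈ nhds x := by
      have : {m : ℕ | m ≠ n} ∈ nhds (c x) := by simp [h]
      exact hc.continuousAt.preimage_mem_nhds this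
    have h1 := hg x ⟨hx, h⟩
    have h2 : ContinuousWithinAt g s x := by
      rw [← continuousWithinAt_inter hU]
      exact h1
    refine h2.congr_of_eventuallyEq ?_ (by simp [h])
    filter_upwards [mem_nhdsWithin_of_mem_nhds hU] with y hy
    exact if_neg hy

theorem empty_le (P : MultiFun) : MultiFun.empty ≤ P :=
  weihrauchLE_iff.2 ⟨id, Prod.snd, continuousOn_id, continuous_snd.continuousOn,
    fun _ hp => absurd hp Set.not_nonempty_empty⟩

theorem le_coprod_left (P Q : MultiFun) : P ≤ P.coprod Q := by
  refine weihrauchLE_iff.2 ⟨cons 0, fun z => tail z.2, (continuous_cons 0).continuousOn,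
    (continuous_tail.comp continuous_snd).continuousOn, ?_⟩
  rintro p ⟨y, hy⟩
  refine ⟨⟨cons 0 y, Or.inl ⟨rfl, y, hy, rfl⟩⟩, ?_⟩
  rintro r (⟨-, z, hz, rfl⟩ | ⟨h, -⟩)
  · exact hz
  · simp at h

theorem le_coprod_right (P Q : MultiFun) : Q ≤ P.coprod Q := by
  refine weihrauchLE_iff.2 ⟨cons 1, fun z => tail z.2, (continuous_cons 1).continuousOn,
    (continuous_tail.comp continuous_snd).continuousOn, ?_⟩
  rintro p ⟨y, hy⟩
  refine ⟨⟨cons 1 y, Or.inr ⟨rfl, y, hy, rfl⟩⟩, ?_⟩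
  rintro r (⟨h, -⟩ | ⟨-, z, hz, rfl⟩)
  · simp at h
  · exact hz

theorem mem_dom_coprod {P Q : MultiFun} {x : Baire} (hx : x ∈ (P.coprod Q).dom) :
    (x 0 = 0 ∧ tail x ∈ P.dom) ∨ (x 0 = 1 ∧ tail x ∈ Q.dom) := by
  obtain ⟨y, ⟨h, z, hz, -⟩ | ⟨h, z, hz, -⟩⟩ := hx
  · exact Or.inl ⟨h, z, hz⟩
  · exact Or.inr ⟨h, z, hz⟩

theorem coprod_le {P Q R : MultiFun} (hP : P ≤ R) (hQ : Q ≤ R) : P.coprod Q ≤ R := by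
  obtain ⟨K, H, hK, hH, h⟩ := weihrauchLE_iff.1 hP
  obtain ⟨K', H', hK', hH', h'⟩ := weihrauchLE_iff.1 hQ
  have hd0 : ∀ x ∈ (P.coprod Q).dom, x 0 = 0 → tail x ∈ P.dom := by
    intro x hx h0
    rcases mem_dom_coprod hx with h | h
    · exact h.2
    · simp [h.1] at h0
  have hd1 : ∀ x ∈ (P.coprod Q).dom, x 0 ≠ 0 → x 0 = 1 ∧ tail x ∈ Q.dom := by
    intro x hx h0
    rcases mem_dom_coprod hx with h | h
    · exact absurd h.1 h0
    · exact h
  have ht : Continuous fun z : Baire × Baire => (tail z.1, z.2) :=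
    (continuous_tail.comp continuous_fst).prodMk continuous_snd
  refine weihrauchLE_iff.2 ⟨fun x => if x 0 = 0 then K (tail x) else K' (tail x),
    fun z => if z.1 0 = 0 then cons 0 (H (tail z.1, z.2)) else cons 1 (H' (tail z.1, z.2)),
    ?_, ?_, ?_⟩
  · refine continuousOn_ite_of_eq (continuous_apply 0) 0 ?_ ?_
    · exact hK.comp continuous_tail.continuousOn fun x hx => hd0 x hx.1 hx.2
    · exact hK'.comp continuous_tail.continuousOn fun x hx => (hd1 x hx.1 hx.2).2
  · refine continuousOn_ite_of_eq ((continuous_apply 0).comp continuous_fst) 0 ?_ ?_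
    · refine (continuous_cons 0).comp_continuousOn (hH.comp ht.continuousOn ?_)
      rintro z ⟨⟨hz, hr⟩, h0⟩
      have h0 : z.1 0 = 0 := h0
      simp only [if_pos h0] at hr
      exact ⟨hd0 _ hz h0, hr⟩
    · refine (continuous_cons 1).comp_continuousOn (hH'.comp ht.continuousOn ?_)
      rintro z ⟨⟨hz, hr⟩, h0⟩
      have h0 : z.1 0 ≠ 0 := h0
      simp only [if_neg h0] at hr
      exact ⟨(hd1 _ hz h0).2, hr⟩
  · intro x hx
    by_cases h0 : x 0 = 0
    · have := h _ (hd0 x hx h0)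
      simp only [if_pos h0]
      exact ⟨this.1, fun r hr => Or.inl ⟨h0, _, this.2 r hr, rfl⟩⟩
    · have h1 := hd1 x hx h0
      have := h' _ h1.2
      simp only [if_neg h0]
      exact ⟨this.1, fun r hr => Or.inr ⟨h1.1, _, this.2 r hr, rfl⟩⟩

theorem mem_dom_oplus {P Q : MultiFun} {x : Baire} :
    x ∈ (P.oplus Q).dom ↔ left x ∈ P.dom ∧ right x ∈ Q.dom := by
  constructor
  · rintro ⟨y, h, h', -⟩
    exact ⟨h, h'⟩
  · rintro ⟨⟨z, hz⟩, h'⟩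
    exact ⟨cons 0 z, ⟨z, hz⟩, h', Or.inl ⟨z, hz, rfl⟩⟩

theorem le_oplus {P Q R : MultiFun} (hP : R ≤ P) (hQ : R ≤ Q) : R ≤ P.oplus Q := by
  obtain ⟨K, H, hK, hH, h⟩ := weihrauchLE_iff.1 hP
  obtain ⟨K', H', hK', hH', h'⟩ := weihrauchLE_iff.1 hQ
  have ht : Continuous fun z : Baire × Baire => (z.1, tail z.2) :=
    continuous_fst.prodMk (continuous_tail.comp continuous_snd)
  refine weihrauchLE_iff.2 ⟨fun x => pair (K x) (K' x),
    fun z => if z.2 0 = 0 then H (z.1, tail z.2) else H' (z.1, tail z.2), ?_, ?_, ?_⟩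
  · exact continuous_pair.comp_continuousOn (hK.prodMk hK')
  · refine continuousOn_ite_of_eq ((continuous_apply 0).comp continuous_snd) 0 ?_ ?_
    · refine hH.comp ht.continuousOn ?_
      rintro ⟨x, y⟩ ⟨⟨hz, -, -, ⟨z, hz', hy⟩ | ⟨z, hz', hy⟩⟩, h0⟩
      · obtain rfl : y = cons 0 z := hy
        exact ⟨hz, by simpa using hz'⟩
      · obtain rfl : y = cons 1 z := hy
        simp at h0
    · refine hH'.comp ht.continuousOn ?_
      rintro ⟨x, y⟩ ⟨⟨hz, -, -, ⟨z, hz', hy⟩ | ⟨z, hz', hy⟩⟩, h0⟩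
      · obtain rfl : y = cons 0 z := hy
        simp at h0
      · obtain rfl : y = cons 1 z := hy
        exact ⟨hz, by simpa using hz'⟩
  · intro p hp
    refine ⟨mem_dom_oplus.2 (by simpa using ⟨(h p hp).1, (h' p hp).1⟩), ?_⟩
    rintro r ⟨-, -, ⟨z, hz, rfl⟩ | ⟨z, hz, rfl⟩⟩
    · simpa using (h p hp).2 z (by simpa using hz)
    · simpa using (h' p hp).2 z (by simpa using hz)

theorem oplus_le_left (P Q : MultiFun) : P.oplus Q ≤ P := by
  refine weihrauchLE_iff.2 ⟨left, fun z => cons 0 z.2, continuous_left.continuousOn,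
    ((continuous_cons 0).comp continuous_snd).continuousOn, fun x hx => ?_⟩
  have hx := mem_dom_oplus.1 hx
  exact ⟨hx.1, fun r hr => ⟨hx.1, hx.2, Or.inl ⟨r, hr, rfl⟩⟩⟩

theorem oplus_le_right (P Q : MultiFun) : P.oplus Q ≤ Q := by
  refine weihrauchLE_iff.2 ⟨right, fun z => cons 1 z.2, continuous_right.continuousOn,
    ((continuous_cons 1).comp continuous_snd).continuousOn, fun x hx => ?_⟩
  have hx := mem_dom_oplus.1 hx
  exact ⟨hx.2, fun r hr => ⟨hx.1, hx.2, Or.inr ⟨r, hr, rfl⟩⟩⟩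

theorem ident_le {P : MultiFun} (hP : P.dom.Nonempty) : MultiFun.ident ≤ P := by
  obtain ⟨q, hq⟩ := hP
  exact weihrauchLE_iff.2 ⟨fun _ => q, Prod.fst, continuousOn_const, continuous_fst.continuousOn,
    fun p _ => ⟨hq, fun _ _ => rfl⟩⟩

theorem le_empty_iff {P : MultiFun} : P ≤ MultiFun.empty ↔ ¬ P.dom.Nonempty := by
  constructor
  · rintro h ⟨p, hp⟩
    obtain ⟨K, H, -, -, h⟩ := weihrauchLE_iff.1 h
    exact Set.not_nonempty_empty (h p hp).1
  · intro h
    exact weihrauchLE_iff.2 ⟨id, Prod.snd, continuousOn_id, continuous_snd.continuousOn,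
      fun p hp => absurd ⟨p, hp⟩ h⟩

/-! ## The continuous Weihrauch lattices -/

/-- The degrees of multi-valued functions under continuous Weihrauch reducibility. -/
abbrev Degree : Type := Antisymmetrization MultiFun (· ≤ ·)

/-- The degrees form a lattice with supremum `∐` and infimum `⊕`. -/
instance : Lattice Degree where
  sup := Quotient.map₂ MultiFun.coprod fun _ _ h _ _ h' =>
    ⟨coprod_le (h.1.trans (le_coprod_left _ _)) (h'.1.trans (le_coprod_right _ _)),
      coprod_le (h.2.trans (le_coprod_left _ _)) (h'.2.trans (le_coprod_right _ _))⟩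
  inf := Quotient.map₂ MultiFun.oplus fun _ _ h _ _ h' =>
    ⟨le_oplus ((oplus_le_left _ _).trans h.1) ((oplus_le_right _ _).trans h'.1),
      le_oplus ((oplus_le_left _ _).trans h.2) ((oplus_le_right _ _).trans h'.2)⟩
  le_sup_left a b := Quotient.inductionOn₂ a b le_coprod_left
  le_sup_right a b := Quotient.inductionOn₂ a b le_coprod_right
  sup_le a b c := Quotient.inductionOn₃ a b c fun _ _ _ h h' => coprod_le h h'
  inf_le_left a b := Quotient.inductionOn₂ a b oplus_le_left
  inf_le_right a b := Quotient.inductionOn₂ a b oplus_le_right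
  le_inf a b c := Quotient.inductionOn₃ a b c fun _ _ _ h h' => le_oplus h h'

/-- The degree of the multi-valued function with empty domain is the smallest degree. -/
instance : OrderBot Degree where
  bot := toAntisymmetrization (· ≤ ·) MultiFun.empty
  bot_le a := Quotient.inductionOn a empty_le

/-- The lattice `𝔆₀`: the continuous Weihrauch degrees, with an artificial top element adjoined. -/
abbrev C0 : Type := WithTop Degree

/-- The continuous Weihrauch degree of a multi-valued function, as an element of `𝔆₀`. -/
def deg (P : MultiFun) : C0 := ((toAntisymmetrization (· ≤ ·) P : Degree) : WithTop Degree)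

theorem deg_le_deg {P Q : MultiFun} : deg P ≤ deg Q ↔ WeihrauchLE P Q :=
  WithTop.coe_le_coe.trans toAntisymmetrization_le_toAntisymmetrization_iff

theorem deg_sup_deg (P Q : MultiFun) : deg P ⊔ deg Q = deg (P.coprod Q) := rfl

theorem deg_inf_deg (P Q : MultiFun) : deg P ⊓ deg Q = deg (P.oplus Q) := rfl

theorem deg_empty : deg MultiFun.empty = ⊥ := rfl

theorem deg_ne_bot {P : MultiFun} : deg P ≠ ⊥ ↔ P.dom.Nonempty := by
  rw [← not_iff_not, not_not, ← le_bot_iff, ← deg_empty, deg_le_deg, ← le_def, le_empty_iff]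

theorem C0_cases (a : C0) : a = ⊤ ∨ ∃ P, a = deg P := by
  induction a using WithTop.recTopCoe with
  | top => exact Or.inl rfl
  | coe a => exact Or.inr (Quotient.inductionOn a fun P => ⟨P, rfl⟩)

theorem deg_ident_le {a : C0} (ha : a ≠ ⊥) : deg MultiFun.ident ≤ a := by
  rcases C0_cases a with rfl | ⟨P, rfl⟩
  · exact le_top
  · exact deg_le_deg.2 (ident_le (deg_ne_bot.1 ha))

theorem deg_ident_ne_bot : deg MultiFun.ident ≠ ⊥ :=
  deg_ne_bot.2 ⟨0, 0, rfl⟩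

/-- The lattice `𝔆`: the elements of `𝔆₀` other than the degree `⊥` of the multi-valued function
with empty domain. -/
abbrev C : Type := {a : C0 // a ≠ ⊥}

/-- `𝔆` is a sublattice of `𝔆₀`. -/
instance : Lattice C :=
  Subtype.lattice (fun _ _ ha _ h => ha (le_bot_iff.1 (le_sup_left.trans h.le)))
    (fun _ _ ha hb h => deg_ident_ne_bot
      (le_bot_iff.1 ((le_inf (deg_ident_le ha) (deg_ident_le hb)).trans h.le)))

instance : BoundedOrder C where
  top := ⟨⊤, fun h => deg_ident_ne_bot (le_bot_iff.1 (le_top.trans h.le))⟩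
  bot := ⟨deg MultiFun.ident, deg_ident_ne_bot⟩
  le_top a := (le_top : a.1 ≤ ⊤)
  bot_le a := deg_ident_le a.2

/-- A bounded lattice is a Brouwer algebra if for all `a`, `b` the set of all `c` with `b ≤ c ⊔ a`
contains a smallest element. -/
def IsBrouwerAlgebra (L : Type*) [Lattice L] [BoundedOrder L] : Prop :=
  ∀ a b : L, ∃ c : L, IsLeast {c : L | b ≤ c ⊔ a} c

/-! ## The combinatorial principles -/

/-- The sequence `p_i`, `i ≥ 1`, of the infinite tuple `x = ⟨p_1, p_2, …⟩`, where `p_i(j)` is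
the entry of `x` at the code of `(i - 1, j)` under Mathlib's pairing bijection `ℕ × ℕ → ℕ`. -/
def component (x : Baire) (i : ℕ) : Baire := fun j => x (Nat.pair (i - 1) j)

/-- The set of all `(i, j)` with `i ≥ 1` and `p_i(j) ≠ 0`, for `x = ⟨p_1, p_2, …⟩`. -/
def nonzeroPositions (x : Baire) : Set (ℕ × ℕ) :=
  {ij | 1 ≤ ij.1 ∧ component x ij.1 ij.2 ≠ 0}

/-- `LLPO_{n,1}` (used for `n > 1`): at most one entry of the input is nonzero, and `i 0^ℕ` with
`1 ≤ i ≤ n` is a value if `p_i = 0^ℕ`. -/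
def LLPO (n : ℕ) : MultiFun where
  values x := {y | (nonzeroPositions x).encard ≤ 1 ∧
    ∃ i, 1 ≤ i ∧ i ≤ n ∧ component x i = 0 ∧ y = cons i 0}

/-- `LLPO_{∞,n}`: at most `n` entries of the input are nonzero, and `i 0^ℕ` with `1 ≤ i` is a value
if `p_i = 0^ℕ`. -/
def LLPOInf (n : ℕ) : MultiFun where
  values x := {y | (nonzeroPositions x).encard ≤ n ∧
    ∃ i, 1 ≤ i ∧ component x i = 0 ∧ y = cons i 0}

/-- `Σ_k^∞ LLPO` (used for `k > 1`): its value at `⟨0^ℕ, p⟩` is `LLPO_{∞,2}(p)`, and its value at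
`⟨0^n 1 0^ℕ, p⟩` is `LLPO_{n,1}(p)` for `n ≥ k`. -/
def sumLLPO (k : ℕ) : MultiFun where
  values x := {y | (left x = 0 ∧ y ∈ (LLPOInf 2).values (right x)) ∨
    ∃ n, k ≤ n ∧ left x = Pi.single n 1 ∧ y ∈ (LLPO n).values (right x)}

end ContWeihrauch

/-! Call `R` a solution if `sumLLPO 2 ≤ R ∐ LLPO 2`. Every `sumLLPO k` with `k ≥ 2` is a solution:
the inputs lost from `sumLLPO 2` are instances of `LLPO n` with `2 ≤ n < k`, which `LLPO 2` answers
(`sumLLPO_two_le_coprod`). By distributivity (`oplus_coprod_le`) the infimum of a solution with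
`sumLLPO k` is again a solution, so a minimal solution would lie below every `sumLLPO k`. In
particular a least solution is impossible once this is.

No solution lies below all of them (`exists_not_le_of_le_coprod`). The zero input must be sent to
`R`, because the at most two answers obtained through `LLPO 2` could both be spoiled by the two
nonzero entries that `LLPOInf 2` allows. By continuity all inputs near zero go to `R`, among them
`⟨0^n 1 0^ℕ, x⟩` for some large `n` and all inputs `x` of `LLPO n` with a long enough zero prefix.
So `R` computes a restriction of `LLPO n` to a neighbourhood of zero.

That restriction is not below `sumLLPO (n + 1)` (`LLPO_restrictZero_not_le`): a reduction colours
the values of `sumLLPO (n + 1)` with `n` answers, and by pigeonhole one colour covers a finite set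
of values that cannot all fail nearby (`sumLLPO_robust`). This colour would be a correct answer for
all inputs near zero, which a single late nonzero entry refutes. The same fact makes the chain of
the `sumLLPO k` strict. -/

namespace ContWeihrauch

open Filter Topology

/-! ## Counting nonzero entries -/

/-- A set of indices with more elements than there are nonzero entries contains the index of a
zero component. -/
theorem exists_component_eq_zero {x : Baire} {F : Finset ℕ} (hF : ∀ i ∈ F, 1 ≤ i)
    (h : (nonzeroPositions x).encard < F.card) : ∃ i ∈ F, component x i = 0 := by
  by_contra! hne
  have hj : ∀ i ∈ F, ∃ j, component x i j ≠ 0 := fun i hi => Function.ne_iff.1 (hne i hi)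
  choose! j hj using hj
  refine h.not_ge ?_
  -- One nonzero position is chosen in each row of `F`; different rows give different positions.
  have hinj : Function.Injective fun i => (i, j i) := fun a b hab => (Prod.ext_iff.1 hab).1
  rw [← Set.encard_coe_eq_coe_finsetCard, ← hinj.encard_image]
  refine Set.encard_le_encard ?_
  rintro _ ⟨i, hi, rfl⟩
  exact ⟨hF i hi, hj i hi⟩

theorem component_eq_zero_of_ne {x : Baire} (hx : (nonzeroPositions x).encard ≤ 1) {i i' j : ℕ}
    (hi : 1 ≤ i) (hi' : 1 ≤ i') (hne : i ≠ i') (hj : component x i j ≠ 0) :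
    component x i' = 0 := by
  obtain ⟨a, ha, h0⟩ := exists_component_eq_zero (x := x) (F := {i, i'})
    (by simp [hi, hi']) (by rw [Finset.card_pair hne]; exact hx.trans_lt (by norm_num))
  rcases Finset.mem_insert.1 ha with rfl | ha
  · exact absurd (congrFun h0 j) hj
  · rwa [Finset.mem_singleton.1 ha] at h0

/-- The indices 1 and 2 outnumber the one permitted nonzero entry. For `n = 1` the equivalence
fails, as `p_1` may be nonzero. -/
theorem mem_dom_LLPO {n : ℕ} (hn : 2 ≤ n) {x : Baire} :
    x ∈ (LLPO n).dom ↔ (nonzeroPositions x).encard ≤ 1 := by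
  refine ⟨fun ⟨y, hy⟩ => hy.1, fun h => ?_⟩
  obtain ⟨i, hi, h0⟩ := exists_component_eq_zero (x := x) (F := {1, 2}) (by simp)
    (h.trans_lt (by norm_num))
  have : 1 ≤ i ∧ i ≤ 2 := by
    rcases Finset.mem_insert.1 hi with rfl | hi
    · omega
    · have := Finset.mem_singleton.1 hi; omega
  exact ⟨cons i 0, h, i, this.1, this.2.trans hn, h0, rfl⟩

theorem mem_dom_LLPOInf {n : ℕ} {x : Baire} :
    x ∈ (LLPOInf n).dom ↔ (nonzeroPositions x).encard ≤ n := by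
  refine ⟨fun ⟨y, hy⟩ => hy.1, fun h => ?_⟩
  obtain ⟨i, hi, h0⟩ := exists_component_eq_zero (x := x) (F := Finset.Icc 1 (n + 1))
    (fun i hi => (Finset.mem_Icc.1 hi).1)
    (h.trans_lt (by simpa using by exact_mod_cast n.lt_succ_self))
  exact ⟨cons i 0, h, i, (Finset.mem_Icc.1 hi).1, h0, rfl⟩

theorem cons_mem_LLPO {n i : ℕ} {x : Baire} : cons i 0 ∈ (LLPO n).values x ↔
    (nonzeroPositions x).encard ≤ 1 ∧ 1 ≤ i ∧ i ≤ n ∧ component x i = 0 := by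
  constructor
  · rintro ⟨h, i', h1, h2, h3, h4⟩
    obtain rfl : i = i' := congrFun h4 0
    exact ⟨h, h1, h2, h3⟩
  · rintro ⟨h, h1, h2, h3⟩
    exact ⟨h, i, h1, h2, h3, rfl⟩

theorem cons_mem_LLPOInf {n i : ℕ} {x : Baire} : cons i 0 ∈ (LLPOInf n).values x ↔
    (nonzeroPositions x).encard ≤ n ∧ 1 ≤ i ∧ component x i = 0 := by
  constructor
  · rintro ⟨h, i', h1, h3, h4⟩
    obtain rfl : i = i' := congrFun h4 0
    exact ⟨h, h1, h3⟩
  · rintro ⟨h, h1, h3⟩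
    exact ⟨h, i, h1, h3, rfl⟩

theorem component_zero (i : ℕ) : component 0 i = 0 := rfl

theorem nonzeroPositions_zero : nonzeroPositions 0 = ∅ := by
  ext; simp [nonzeroPositions, component_zero]

theorem continuous_component_apply (i j : ℕ) : Continuous fun x => component x i j :=
  continuous_apply _

/-! ## Inputs with few late nonzero entries -/

open Classical in
/-- The tuple with `p_c(j) = 1` for `c ∈ C`, and all other entries zero. -/
noncomputable def spike (C : Finset ℕ) (j : ℕ) : Baire := fun t =>
  if ∃ c ∈ C, t = Nat.pair (c - 1) j then 1 else 0

theorem component_spike {C : Finset ℕ} {c : ℕ} (hc : c ∈ C) (j : ℕ) :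
    component (spike C j) c j = 1 := if_pos ⟨c, hc, rfl⟩

theorem encard_nonzeroPositions_spike {C : Finset ℕ} (hC : ∀ c ∈ C, 1 ≤ c) (j : ℕ) :
    (nonzeroPositions (spike C j)).encard ≤ C.card := by
  have hsub : nonzeroPositions (spike C j) ⊆ (fun c => (c, j)) '' (C : Set ℕ) := by
    rintro ⟨i, j'⟩ ⟨hi, h⟩
    have : ∃ c ∈ C, Nat.pair (i - 1) j' = Nat.pair (c - 1) j := by
      by_contra hn
      exact h (if_neg hn)
    obtain ⟨c, hc, he⟩ := this
    obtain ⟨h1, rfl⟩ := Nat.pair_eq_pair.1 he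
    have := hC c hc
    have hi : 1 ≤ i := hi
    exact ⟨c, hc, by simp; omega⟩
  refine (Set.encard_le_encard hsub).trans ((Set.encard_image_le _ _).trans ?_)
  rw [Set.encard_coe_eq_coe_finsetCard]

theorem spike_eq_zero (C : Finset ℕ) {j t : ℕ} (h : t < j) : spike C j t = 0 := by
  refine if_neg ?_
  rintro ⟨c, -, rfl⟩
  exact (Nat.right_le_pair (c - 1) j).not_gt h

/-- Since `Nat.pair (c - 1) j ≥ j`, the nonzero entries leave every finite prefix. So inputs
arbitrarily close to zero make all indices in `C` wrong. -/
theorem tendsto_spike (C : Finset ℕ) : Tendsto (spike C) atTop (𝓝 0) := by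
  refine tendsto_pi_nhds.2 fun t => tendsto_const_nhds.congr' ?_
  filter_upwards [eventually_gt_atTop t] with j hj
  exact (spike_eq_zero C hj).symm

/-! ## Robust sets of values -/

/-- A finite set of values at `y` is robust if each input near `y` in the domain still has one of
its elements as a value. -/
def Robust (Q : MultiFun) (y : Baire) (F : Set Baire) : Prop :=
  F.Finite ∧ (∀ r ∈ F, r ∈ Q.values y) ∧ ∀ᶠ y' in 𝓝[Q.dom] y, ∃ r ∈ F, r ∈ Q.values y'

theorem eventually_eq_of_continuousOn {X : Type*} [TopologicalSpace X] {f : X → Baire} {s : Set X}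
    (hf : ContinuousOn f s) {x : X} (hx : x ∈ s) (n : ℕ) :
    ∀ᶠ x' in 𝓝[s] x, f x' n = f x n := by
  have h := ((continuous_apply n).comp_continuousOn hf) x hx
  exact h.eventually (by simp : ∀ᶠ m in 𝓝 (f x n), m = f x n)

/-- If a reduction of `P` to `Q` has a robust set of values at `K x₀`, then the first symbols of the
resulting values of `P` at `x₀` remain sufficient near `x₀`. -/
theorem Robust.eventually_values {P Q : MultiFun} {K : Baire → Baire} {H : Baire × Baire → Baire}
    (hK : ContinuousOn K P.dom)
    (hH : ContinuousOn H {z | z.1 ∈ P.dom ∧ z.2 ∈ Q.values (K z.1)})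
    (h : ∀ p ∈ P.dom, K p ∈ Q.dom ∧ ∀ r ∈ Q.values (K p), H (p, r) ∈ P.values p)
    {x₀ : Baire} (hx₀ : x₀ ∈ P.dom) {F : Set Baire} (hF : Robust Q (K x₀) F) :
    ∀ᶠ x in 𝓝[P.dom] x₀, ∃ r ∈ F, ∃ z ∈ P.values x, z 0 = H (x₀, r) 0 := by
  obtain ⟨hfin, hval, hev⟩ := hF
  have hKt : Tendsto K (𝓝[P.dom] x₀) (𝓝[Q.dom] K x₀) :=
    tendsto_nhdsWithin_of_tendsto_nhds_of_eventually_within _ (hK x₀ hx₀)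
      (eventually_nhdsWithin_of_forall fun p hp => (h p hp).1)
  have hHr : ∀ r ∈ F, ∀ᶠ x in 𝓝[P.dom] x₀,
      r ∈ Q.values (K x) → H (x, r) 0 = H (x₀, r) 0 := by
    intro r hr
    -- Joint continuity of `H` at `(x₀, r)` is used with `r` held fixed.
    have h1 := eventually_nhdsWithin_iff.1
      (eventually_eq_of_continuousOn hH (x := (x₀, r)) ⟨hx₀, hval r hr⟩ 0)
    have h2 : Tendsto (fun x : Baire => (x, r)) (𝓝 x₀) (𝓝 (x₀, r)) :=
      (continuous_id.prodMk continuous_const).tendsto x₀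
    filter_upwards [eventually_nhdsWithin_of_eventually_nhds (h2.eventually h1),
      self_mem_nhdsWithin] with x hx hxP hxr
    exact hx ⟨hxP, hxr⟩
  -- Finiteness of `F` lets the neighbourhoods belonging to its elements be intersected.
  filter_upwards [hKt.eventually hev, (eventually_all_finite hfin).2 hHr, self_mem_nhdsWithin]
    with x ⟨r, hrF, hr⟩ hx hxP
  exact ⟨r, hrF, _, (h x hxP).2 r hr, hx r hrF hr⟩

/-- At an input of `LLPO_{n,1}`, either all indices are correct, or one of them is correct in a
neighbourhood. -/
theorem LLPO_robust {n : ℕ} (hn : 2 ≤ n) {y : Baire} (hy : y ∈ (LLPO n).dom) :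
    (∀ i, 1 ≤ i → i ≤ n → cons i 0 ∈ (LLPO n).values y) ∨
      ∃ i, 1 ≤ i ∧ i ≤ n ∧ ∀ᶠ y' in 𝓝 y, y' ∈ (LLPO n).dom → cons i 0 ∈ (LLPO n).values y' := by
  have hy1 := (mem_dom_LLPO hn).1 hy
  by_cases hall : ∀ i, 1 ≤ i → i ≤ n → component y i = 0
  · exact Or.inl fun i h1 h2 => cons_mem_LLPO.2 ⟨hy1, h1, h2, hall i h1 h2⟩
  · push Not at hall
    obtain ⟨i, h1, h2, hi⟩ := hall
    obtain ⟨j, hj⟩ := Function.ne_iff.1 hi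
    obtain ⟨i', h1', h2', hne⟩ : ∃ i', 1 ≤ i' ∧ i' ≤ n ∧ i ≠ i' := by
      by_cases hi1 : i = 1
      · exact ⟨2, by omega, hn, by omega⟩
      · exact ⟨1, le_rfl, by omega, hi1⟩
    refine Or.inr ⟨i', h1', h2', ?_⟩
    -- The nonzero entry persists nearby and uses up the allowance, so every other index is correct
    -- there.
    have hev : ∀ᶠ y' in 𝓝 y, component y' i j = component y i j :=
      (continuous_component_apply i j).continuousAt.eventually
        (by simp : ∀ᶠ m in 𝓝 (component y i j), m = component y i j)
    filter_upwards [hev] with y' hy' hd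
    have hd1 := (mem_dom_LLPO hn).1 hd
    refine cons_mem_LLPO.2 ⟨hd1, h1', h2', component_eq_zero_of_ne hd1 h1 h1' hne (j := j) ?_⟩
    rw [hy']
    exact hj

/-! ### Robust sets for the infinite sums -/

theorem single_one_ne_zero (n : ℕ) : (Pi.single n 1 : Baire) ≠ 0 := by simp

theorem eq_of_single_one_apply_ne_zero {n m : ℕ} (h : (Pi.single n 1 : Baire) m ≠ 0) : m = n := by
  by_contra hne
  exact h (Pi.single_eq_of_ne hne _)

theorem mem_dom_sumLLPO {k : ℕ} {x : Baire} (h : x ∈ (sumLLPO k).dom) :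
    (left x = 0 ∧ right x ∈ (LLPOInf 2).dom) ∨
      ∃ n, k ≤ n ∧ left x = Pi.single n 1 ∧ right x ∈ (LLPO n).dom := by
  obtain ⟨y, ⟨h0, hy⟩ | ⟨n, hn, h1, hy⟩⟩ := h
  · exact Or.inl ⟨h0, y, hy⟩
  · exact Or.inr ⟨n, hn, h1, y, hy⟩

/-- Every colouring with `k` colours of the values of `Σ_{k+1}^∞ LLPO` at some input is constant on
some robust set of values. -/
theorem sumLLPO_robust {k : ℕ} (hk : 1 ≤ k) {y : Baire} (hy : y ∈ (sumLLPO (k + 1)).dom)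
    (f : Baire → ℕ) (hf : ∀ r ∈ (sumLLPO (k + 1)).values y, f r ∈ Finset.Icc 1 k) :
    ∃ c ∈ Finset.Icc 1 k, ∃ F, Robust (sumLLPO (k + 1)) y F ∧ ∀ r ∈ F, f r = c := by
  classical
  rcases mem_dom_sumLLPO hy with ⟨hl, hr⟩ | ⟨n, hn, hl, hr⟩
  · have hr2 := mem_dom_LLPOInf.1 hr
    have hfin : (Prod.fst '' nonzeroPositions (right y)).Finite :=
      (Set.finite_of_encard_le_coe hr2).image _
    have hval : ∀ i, i ∈ {i | 1 ≤ i} \ Prod.fst '' nonzeroPositions (right y) →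
        cons i 0 ∈ (sumLLPO (k + 1)).values y := by
      rintro i ⟨h1, h2⟩
      refine Or.inl ⟨hl, cons_mem_LLPOInf.2 ⟨hr2, h1, funext fun j => ?_⟩⟩
      by_contra hj
      exact h2 ⟨(i, j), ⟨h1, hj⟩, rfl⟩
    have hinf : ({i | 1 ≤ i} \ Prod.fst '' nonzeroPositions (right y)).Infinite :=
      (Set.infinite_of_not_bddAbove (not_bddAbove_Ici 1)).sdiff hfin
    -- Among `2 * k + 1` correct indices three share a colour, one more than the permitted nonzero
    -- entries can spoil.
    obtain ⟨A, hA, hAc⟩ := hinf.exists_subset_card_eq (2 * k + 1)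
    obtain ⟨c, hc, hcard⟩ := Finset.exists_lt_card_fiber_of_mul_lt_card_of_maps_to
      (s := A) (t := Finset.Icc 1 k) (f := fun i => f (cons i 0)) (n := 2)
      (fun i hi => hf _ (hval i (hA hi))) (by simp; omega)
    set B := A.filter fun i => f (cons i 0) = c with hB
    have hBA : ∀ i ∈ B, i ∈ A := fun i hi => (Finset.mem_filter.1 hi).1
    have hB1 : ∀ i ∈ B, 1 ≤ i := fun i hi => (hA (hBA i hi)).1
    refine ⟨c, hc, (fun i => cons i 0) '' (B : Set ℕ), ⟨B.finite_toSet.image _, ?_, ?_⟩, ?_⟩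
    · rintro _ ⟨i, hi, rfl⟩
      exact hval i (hA (hBA i hi))
    · have hev : ∀ᶠ y' in 𝓝 y, ∀ i ∈ B, ∀ m ∈ Finset.range i, left y' m = 0 := by
        refine (eventually_all_finset _).2 fun i _ => (eventually_all_finset _).2 fun m _ => ?_
        have := eventually_eq_of_continuousOn continuous_left.continuousOn (Set.mem_univ y) m
        rw [nhdsWithin_univ, hl] at this
        exact this
      filter_upwards [eventually_nhdsWithin_of_eventually_nhds hev, self_mem_nhdsWithin]
        with y' hy' hd
      rcases mem_dom_sumLLPO hd with ⟨hl', hr'⟩ | ⟨n, hn, hl', hr'⟩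
      · have h2 := mem_dom_LLPOInf.1 hr'
        obtain ⟨i, hi, h0⟩ := exists_component_eq_zero hB1
          (h2.trans_lt (by exact_mod_cast hcard))
        exact ⟨_, ⟨i, hi, rfl⟩, Or.inl ⟨hl', cons_mem_LLPOInf.2 ⟨h2, hB1 i hi, h0⟩⟩⟩
      · have h1 := (mem_dom_LLPO (by omega)).1 hr'
        obtain ⟨i, hi, h0⟩ := exists_component_eq_zero hB1
          (h1.trans_lt (by exact_mod_cast (by omega : 1 < B.card)))
        refine ⟨_, ⟨i, hi, rfl⟩, Or.inr ⟨n, hn, hl', cons_mem_LLPO.2 ⟨h1, hB1 i hi, ?_, h0⟩⟩⟩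
        by_contra! hlt
        have := hy' i hi n (Finset.mem_range.2 hlt)
        simp [hl'] at this
    · rintro _ ⟨i, hi, rfl⟩
      exact (Finset.mem_filter.1 hi).2
  -- The entry 1 at position `n` is visible in a finite prefix, so nearby inputs of the domain
  -- belong to the same `LLPO n`.
  · have hev : ∀ᶠ y' in 𝓝[(sumLLPO (k + 1)).dom] y,
        left y' = Pi.single n 1 ∧ right y' ∈ (LLPO n).dom := by
      have h1 := eventually_eq_of_continuousOn continuous_left.continuousOn (Set.mem_univ y) n
      rw [nhdsWithin_univ, hl] at h1
      filter_upwards [eventually_nhdsWithin_of_eventually_nhds h1, self_mem_nhdsWithin]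
        with y' hy' hd
      rcases mem_dom_sumLLPO hd with ⟨hl', -⟩ | ⟨n', -, hl', hr'⟩
      · simp [hl'] at hy'
      · obtain rfl := eq_of_single_one_apply_ne_zero (n := n') (m := n) (by rw [← hl', hy']; simp)
        exact ⟨hl', hr'⟩
    rcases LLPO_robust (by omega : 2 ≤ n) hr with hall | ⟨i, h1, h2, hi⟩
    · have hval : ∀ i ∈ Finset.Icc 1 n, cons i 0 ∈ (sumLLPO (k + 1)).values y := fun i hi =>
        Or.inr ⟨n, hn, hl, hall i (Finset.mem_Icc.1 hi).1 (Finset.mem_Icc.1 hi).2⟩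
      -- Here `n ≥ k + 1`, so two of the `n` values share a colour, and a single nonzero entry
      -- cannot spoil both.
      obtain ⟨i, hi, i', hi', hne, he⟩ := Finset.exists_ne_map_eq_of_card_lt_of_maps_to
        (s := Finset.Icc 1 n) (t := Finset.Icc 1 k) (by simp; omega)
        (f := fun i => f (cons i 0)) fun i hi => hf _ (hval i hi)
      refine ⟨f (cons i 0), hf _ (hval i hi), {cons i 0, cons i' 0}, ⟨by simp, ?_, ?_⟩, ?_⟩
      · rintro r (rfl | rfl)
        exacts [hval i hi, hval i' hi']
      · filter_upwards [hev] with y' hy'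
        have hd := (mem_dom_LLPO (by omega)).1 hy'.2
        have hsub : ∀ a ∈ ({i, i'} : Finset ℕ), a ∈ Finset.Icc 1 n := by
          intro a ha
          rcases Finset.mem_insert.1 ha with rfl | ha
          · exact hi
          · rwa [Finset.mem_singleton.1 ha]
        obtain ⟨a, ha, h0⟩ := exists_component_eq_zero (x := right y') (F := {i, i'})
          (fun a ha => (Finset.mem_Icc.1 (hsub a ha)).1)
          (by rw [Finset.card_pair hne]; exact hd.trans_lt (by norm_num))
        have hab := Finset.mem_Icc.1 (hsub a ha)
        refine ⟨cons a 0, ?_, Or.inr ⟨n, hn, hy'.1, cons_mem_LLPO.2 ⟨hd, hab.1, hab.2, h0⟩⟩⟩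
        rcases Finset.mem_insert.1 ha with rfl | ha
        · exact Or.inl rfl
        · rw [Finset.mem_singleton.1 ha]
          exact Or.inr rfl
      · rintro r (rfl | rfl)
        exacts [rfl, he.symm]
    · have hval : cons i 0 ∈ (sumLLPO (k + 1)).values y := Or.inr ⟨n, hn, hl, hi.self_of_nhds hr⟩
      refine ⟨_, hf _ hval, {cons i 0}, ⟨by simp, ?_, ?_⟩, ?_⟩
      · rintro r rfl
        exact hval
      · filter_upwards [hev, eventually_nhdsWithin_of_eventually_nhds
          ((continuous_right.tendsto y).eventually hi)] with y' hy' hiy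
        exact ⟨_, rfl, Or.inr ⟨n, hn, hy'.1, hiy hy'.2⟩⟩
      · rintro r rfl
        rfl

/-! ## Reductions between the principles -/

/-- The restriction of a multi-valued function to the inputs whose first `m` entries vanish. -/
def MultiFun.restrictZero (P : MultiFun) (m : ℕ) : MultiFun where
  values x := {y | (∀ t < m, x t = 0) ∧ y ∈ P.values x}

theorem MultiFun.restrictZero_le (P : MultiFun) (m : ℕ) : P.restrictZero m ≤ P :=
  weihrauchLE_iff.2 ⟨id, Prod.snd, continuousOn_id, continuous_snd.continuousOn,
    fun _ ⟨y, hy⟩ => ⟨⟨y, hy.2⟩, fun _ hr => ⟨hy.1, hr⟩⟩⟩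

/-- Values of `sumLLPO (n + 1)` at `K 0` are coloured by the answers in `{1, …, n}` that they yield
at 0. A robust colour `c` would stay correct near 0, but a late spike in row `c` contradicts it. The
argument is local, so a prescribed zero prefix does no harm. -/
theorem LLPO_restrictZero_not_le {n : ℕ} (hn : 2 ≤ n) (m : ℕ) :
    ¬ (LLPO n).restrictZero m ≤ sumLLPO (n + 1) := by
  intro hle
  obtain ⟨K, H, hK, hH, h⟩ := weihrauchLE_iff.1 hle
  have hdom : ∀ x, (∀ t < m, x t = 0) → (nonzeroPositions x).encard ≤ 1 →
      x ∈ ((LLPO n).restrictZero m).dom := by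
    intro x hx hx1
    obtain ⟨y, hy⟩ := (mem_dom_LLPO hn).2 hx1
    exact ⟨y, hx, hy⟩
  have h0 : (0 : Baire) ∈ ((LLPO n).restrictZero m).dom :=
    hdom 0 (fun _ _ => rfl) (by simp [nonzeroPositions_zero])
  obtain ⟨c, hc, F, hF, hFc⟩ := sumLLPO_robust (by omega : 1 ≤ n) (h 0 h0).1
    (fun r => H (0, r) 0) (by
      intro r hr
      obtain ⟨-, -, i, h1, h2, -, hi⟩ := (h 0 h0).2 r hr
      simp [hi, h1, h2])
  have hev := hF.eventually_values hK hH h h0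
  have ht : Tendsto (spike {c}) atTop (𝓝[((LLPO n).restrictZero m).dom] 0) := by
    refine tendsto_nhdsWithin_of_tendsto_nhds_of_eventually_within _ (tendsto_spike _) ?_
    filter_upwards [eventually_ge_atTop m] with j hj
    refine hdom _ (fun t ht => spike_eq_zero _ (ht.trans_le hj)) ?_
    refine (encard_nonzeroPositions_spike ?_ j).trans (by simp)
    simpa using (Finset.mem_Icc.1 hc).1
  obtain ⟨j, r, hr, z, ⟨-, -, i, -, -, hi, rfl⟩, hz⟩ := (ht.eventually hev).exists
  obtain rfl : i = c := hz.trans (hFc r hr)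
  have := component_spike (Finset.mem_singleton_self i) j
  simp [hi] at this

theorem continuous_pair_right (q : Baire) : Continuous fun x => pair q x :=
  continuous_pair.comp (continuous_const.prodMk continuous_id)

theorem LLPO_le_sumLLPO {k n : ℕ} (hkn : k ≤ n) : LLPO n ≤ sumLLPO k := by
  refine weihrauchLE_iff.2 ⟨fun x => pair (Pi.single n 1) x, Prod.snd,
    (continuous_pair_right _).continuousOn,
    continuous_snd.continuousOn, ?_⟩
  rintro p ⟨y, hy⟩
  refine ⟨⟨y, Or.inr ⟨n, hkn, by simp, by simpa using hy⟩⟩, ?_⟩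
  rintro r (⟨hl, -⟩ | ⟨n', -, hl, hr⟩)
  · simp at hl
  · rw [left_pair] at hl
    obtain rfl := eq_of_single_one_apply_ne_zero (n := n') (m := n) (by rw [← hl]; simp)
    simpa using hr

theorem sumLLPO_succ_le (k : ℕ) : sumLLPO (k + 1) ≤ sumLLPO k := by
  refine weihrauchLE_iff.2 ⟨id, Prod.snd, continuousOn_id, continuous_snd.continuousOn, ?_⟩
  intro p hp
  refine ⟨?_, ?_⟩
  · obtain ⟨y, ⟨h0, hy⟩ | ⟨n, hn, h1, hy⟩⟩ := hp
    · exact ⟨y, Or.inl ⟨h0, hy⟩⟩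
    · exact ⟨y, Or.inr ⟨n, by omega, h1, hy⟩⟩
  · rintro r (⟨h0, hr⟩ | ⟨n, -, h1, hr⟩)
    · exact Or.inl ⟨h0, hr⟩
    · rcases mem_dom_sumLLPO hp with ⟨h0, -⟩ | ⟨n', hn', h1', -⟩
      · exact absurd (h1.symm.trans h0) (single_one_ne_zero n)
      · have h1 : left p = Pi.single n 1 := h1
        obtain rfl := eq_of_single_one_apply_ne_zero (n := n') (m := n) (by rw [← h1', h1]; simp)
        exact Or.inr ⟨n, hn', h1, hr⟩

/-- `LLPO k` separates the two; the restriction is vacuous for `m = 0`. -/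
theorem sumLLPO_not_le_succ {k : ℕ} (hk : 2 ≤ k) : ¬ sumLLPO k ≤ sumLLPO (k + 1) := fun h =>
  LLPO_restrictZero_not_le hk 0
    (((MultiFun.restrictZero_le _ _).trans (LLPO_le_sumLLPO le_rfl)).trans h)

theorem LLPO_values_mono {n m : ℕ} (h : n ≤ m) (x : Baire) :
    (LLPO n).values x ⊆ (LLPO m).values x := by
  rintro y ⟨h0, i, h1, h2, h3⟩
  exact ⟨h0, i, h1, h2.trans h, h3⟩

/-- The only inputs to be redirected are those with left part `0^k 1 0^ℕ`, recognised by a single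
entry; an answer of `LLPO 2` is also one of `LLPO k`. -/
theorem sumLLPO_le_coprod {k : ℕ} (hk : 2 ≤ k) :
    sumLLPO k ≤ (sumLLPO (k + 1)).coprod (LLPO 2) := by
  have hd1 : ∀ x ∈ (sumLLPO k).dom, left x k = 1 →
      left x = Pi.single k 1 ∧ right x ∈ (LLPO 2).dom := by
    intro x hx h1
    rcases mem_dom_sumLLPO hx with ⟨hl, -⟩ | ⟨n, hn, hl, hr⟩
    · simp [hl] at h1
    · obtain rfl := eq_of_single_one_apply_ne_zero (n := n) (m := k) (by rw [← hl, h1]; simp)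
      exact ⟨hl, (mem_dom_LLPO le_rfl).2 ((mem_dom_LLPO hk).1 hr)⟩
  have hd0 : ∀ x ∈ (sumLLPO k).dom, left x k ≠ 1 → x ∈ (sumLLPO (k + 1)).dom := by
    rintro x ⟨y, ⟨hl, hy⟩ | ⟨n, hn, hl, hy⟩⟩ h1
    · exact ⟨y, Or.inl ⟨hl, hy⟩⟩
    · refine ⟨y, Or.inr ⟨n, ?_, hl, hy⟩⟩
      have : n ≠ k := by
        rintro rfl
        simp [hl] at h1
      omega
  have hc : Continuous fun x => left x k := (continuous_apply k).comp continuous_left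
  refine weihrauchLE_iff.2 ⟨fun x => if left x k = 1 then cons 1 (right x) else cons 0 x,
    fun z => tail z.2, ?_, (continuous_tail.comp continuous_snd).continuousOn, ?_⟩
  · exact continuousOn_ite_of_eq hc 1 ((continuous_cons 1).comp continuous_right).continuousOn
      (continuous_cons 0).continuousOn
  · intro p hp
    by_cases h1 : left p k = 1
    · obtain ⟨hl, y, hy⟩ := hd1 p hp h1
      simp only [if_pos h1]
      refine ⟨⟨cons 1 y, Or.inr ⟨rfl, y, hy, rfl⟩⟩, ?_⟩
      rintro r (⟨h, -⟩ | ⟨-, z, hz, rfl⟩)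
      · simp at h
      · exact Or.inr ⟨k, le_rfl, hl, LLPO_values_mono hk _ hz⟩
    · obtain ⟨y, hy⟩ := hd0 p hp h1
      simp only [if_neg h1]
      refine ⟨⟨cons 0 y, Or.inl ⟨rfl, y, hy, rfl⟩⟩, ?_⟩
      rintro r (⟨-, z, hz, rfl⟩ | ⟨h, -⟩)
      · rcases hz with ⟨h0, hr⟩ | ⟨n, hn, hl, hr⟩
        · exact Or.inl ⟨h0, hr⟩
        · exact Or.inr ⟨n, by omega, hl, hr⟩
      · simp at h

theorem sumLLPO_two_le_coprod {k : ℕ} (hk : 2 ≤ k) :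
    sumLLPO 2 ≤ (sumLLPO k).coprod (LLPO 2) := by
  induction k, hk using Nat.le_induction with
  | base => exact le_coprod_left _ _
  | succ k hk ih =>
    exact ih.trans (coprod_le (sumLLPO_le_coprod hk) (le_coprod_right _ _))

/-- The distributivity inequality of the continuous Weihrauch lattice. -/
theorem oplus_coprod_le (P Q A : MultiFun) :
    (P.coprod A).oplus (Q.coprod A) ≤ (P.oplus Q).coprod A := by
  have hd : ∀ x ∈ ((P.coprod A).oplus (Q.coprod A)).dom, left x 0 ≠ 0 →
      left x 0 = 1 ∧ tail (left x) ∈ A.dom := by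
    intro x hx h
    rcases mem_dom_coprod (mem_dom_oplus.1 hx).1 with h' | h'
    · exact absurd h'.1 h
    · exact h'
  have hd' : ∀ x ∈ ((P.coprod A).oplus (Q.coprod A)).dom, right x 0 ≠ 0 →
      right x 0 = 1 ∧ tail (right x) ∈ A.dom := by
    intro x hx h
    rcases mem_dom_coprod (mem_dom_oplus.1 hx).2 with h' | h'
    · exact absurd h'.1 h
    · exact h'
  have hl : Continuous fun x => left x 0 := (continuous_apply 0).comp continuous_left
  have hr : Continuous fun x => right x 0 := (continuous_apply 0).comp continuous_right
  have htl := continuous_tail.comp continuous_left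
  have htr := continuous_tail.comp continuous_right
  have hz : Continuous fun z : Baire × Baire => tail z.2 := continuous_tail.comp continuous_snd
  have hc : ∀ n m, Continuous fun z : Baire × Baire => cons n (cons m (tail z.2)) := fun n m =>
    (continuous_cons n).comp ((continuous_cons m).comp hz)
  have hcc : Continuous fun z : Baire × Baire => cons (tail z.2 0) (cons 0 (tail (tail z.2))) := by
    refine continuous_pi fun t => ?_
    rcases t with _ | t
    · exact (continuous_apply 0).comp hz
    · exact (continuous_apply t).comp ((continuous_cons 0).comp (continuous_tail.comp hz))
  -- If a component of the input queries `A`, that query alone is made (the left one first) and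
  -- answers for this component. Otherwise both queries go to `P ⊕ Q`, and the tags of the answer
  -- are swapped from `0 i w` to `i 0 w`.
  refine weihrauchLE_iff.2 ⟨fun x => if left x 0 = 0 then
      (if right x 0 = 0 then cons 0 (pair (tail (left x)) (tail (right x)))
        else cons 1 (tail (right x))) else cons 1 (tail (left x)),
    fun z => if left z.1 0 = 0 then
      (if right z.1 0 = 0 then cons (tail z.2 0) (cons 0 (tail (tail z.2)))
        else cons 1 (cons 1 (tail z.2))) else cons 0 (cons 1 (tail z.2)), ?_, ?_, ?_⟩
  · refine continuousOn_ite_of_eq hl 0 (continuousOn_ite_of_eq hr 0 ?_ ?_) ?_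
    · exact ((continuous_cons 0).comp (continuous_pair.comp (htl.prodMk htr))).continuousOn
    · exact ((continuous_cons 1).comp htr).continuousOn
    · exact ((continuous_cons 1).comp htl).continuousOn
  · refine continuousOn_ite_of_eq (hl.comp continuous_fst) 0
      (continuousOn_ite_of_eq (hr.comp continuous_fst) 0 ?_ ?_) ?_
    · exact hcc.continuousOn
    · exact (hc 1 1).continuousOn
    · exact (hc 0 1).continuousOn
  · intro x hx
    have hx' := mem_dom_oplus.1 hx
    by_cases h0 : left x 0 = 0
    · by_cases h1 : right x 0 = 0
      · have hP : tail (left x) ∈ P.dom := by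
          rcases mem_dom_coprod hx'.1 with h | h
          · exact h.2
          · simp [h0] at h
        have hQ : tail (right x) ∈ Q.dom := by
          rcases mem_dom_coprod hx'.2 with h | h
          · exact h.2
          · simp [h1] at h
        simp only [if_pos h0, if_pos h1]
        constructor
        · obtain ⟨y, hy⟩ := (mem_dom_oplus (P := P) (Q := Q)
            (x := pair (tail (left x)) (tail (right x)))).2 (by simpa using ⟨hP, hQ⟩)
          exact ⟨cons 0 y, Or.inl ⟨rfl, y, hy, rfl⟩⟩
        · rintro r (⟨-, z, ⟨-, -, ⟨w, hw, rfl⟩ | ⟨w, hw, rfl⟩⟩, rfl⟩ | ⟨h, -⟩)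
          · exact ⟨hx'.1, hx'.2, Or.inl ⟨cons 0 w, Or.inl ⟨h0, w, by simpa using hw, rfl⟩, rfl⟩⟩
          · exact ⟨hx'.1, hx'.2, Or.inr ⟨cons 0 w, Or.inl ⟨h1, w, by simpa using hw, rfl⟩, rfl⟩⟩
          · simp at h
      · obtain ⟨h1', y, hy⟩ := hd' x hx h1
        simp only [if_pos h0, if_neg h1]
        refine ⟨⟨cons 1 y, Or.inr ⟨rfl, y, hy, rfl⟩⟩, ?_⟩
        rintro r (⟨h, -⟩ | ⟨-, z, hz, rfl⟩)
        · simp at h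
        · exact ⟨hx'.1, hx'.2, Or.inr ⟨cons 1 z, Or.inr ⟨h1', z, hz, rfl⟩, rfl⟩⟩
    · obtain ⟨h0', y, hy⟩ := hd x hx h0
      simp only [if_neg h0]
      refine ⟨⟨cons 1 y, Or.inr ⟨rfl, y, hy, rfl⟩⟩, ?_⟩
      rintro r (⟨h, -⟩ | ⟨-, z, hz, rfl⟩)
      · simp at h
      · exact ⟨hx'.1, hx'.2, Or.inl ⟨cons 1 z, Or.inr ⟨h0', z, hz, rfl⟩, rfl⟩⟩

/-! ## Nonexistence of minimal solutions -/

theorem spike_mem_dom_sumLLPO {k j : ℕ} {C : Finset ℕ} (hC : ∀ c ∈ C, 1 ≤ c) (hcard : C.card ≤ 2) :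
    pair 0 (spike C j) ∈ (sumLLPO k).dom := by
  obtain ⟨y, hy⟩ := mem_dom_LLPOInf.2
    ((encard_nonzeroPositions_spike hC j).trans (by exact_mod_cast hcard : _ ≤ ((2 : ℕ) : ℕ∞)))
  exact ⟨y, Or.inl ⟨by simp, by simpa using hy⟩⟩

/-- A reduction of `Σ_k^∞ LLPO` to `R ∐ LLPO_{2,1}` sends the zero input to the side of `R`. -/
theorem coprod_LLPO_reduction_apply_zero {k : ℕ} {R : MultiFun} {K : Baire → Baire}
    {H : Baire × Baire → Baire} (hK : ContinuousOn K (sumLLPO k).dom)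
    (hH : ContinuousOn H
      {z | z.1 ∈ (sumLLPO k).dom ∧ z.2 ∈ (R.coprod (LLPO 2)).values (K z.1)})
    (h : ∀ p ∈ (sumLLPO k).dom, K p ∈ (R.coprod (LLPO 2)).dom ∧
      ∀ r ∈ (R.coprod (LLPO 2)).values (K p), H (p, r) ∈ (sumLLPO k).values p)
    (h0 : (0 : Baire) ∈ (sumLLPO k).dom) : K 0 0 = 0 := by
  classical
  -- On the side of `LLPO 2` a robust set of at most two values exists, hence at most two answers
  -- `C` at 0. Spiking all rows in `C` stays within the two nonzero entries of `LLPOInf 2` and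
  -- refutes them all.
  by_contra hne
  have hK0 : K 0 0 = 1 ∧ tail (K 0) ∈ (LLPO 2).dom := by
    rcases mem_dom_coprod (h 0 h0).1 with h | h
    · exact absurd h.1 hne
    · exact h
  have hev : ∀ᶠ y in 𝓝[(R.coprod (LLPO 2)).dom] K 0, y 0 = 1 ∧ tail y ∈ (LLPO 2).dom := by
    have h1 := eventually_eq_of_continuousOn (continuousOn_id (s := Set.univ)) (Set.mem_univ (K 0)) 0
    rw [nhdsWithin_univ] at h1
    filter_upwards [eventually_nhdsWithin_of_eventually_nhds h1, self_mem_nhdsWithin] with y hy hd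
    rcases mem_dom_coprod hd with h | h
    · exact absurd (hy.symm.trans h.1) hne
    · exact h
  have hlift : ∀ {y : Baire} {i : ℕ}, y 0 = 1 → cons i 0 ∈ (LLPO 2).values (tail y) →
      cons 1 (cons i 0) ∈ (R.coprod (LLPO 2)).values y := fun hy hi => Or.inr ⟨hy, _, hi, rfl⟩
  obtain ⟨I, hI, hF⟩ : ∃ I : Finset ℕ, I.card ≤ 2 ∧
      Robust (R.coprod (LLPO 2)) (K 0) ((fun i => cons 1 (cons i 0)) '' (I : Set ℕ)) := by
    rcases LLPO_robust le_rfl hK0.2 with hall | ⟨i, h1, h2, hi⟩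
    · refine ⟨Finset.Icc 1 2, by simp, (Finset.finite_toSet _).image _, ?_, ?_⟩
      · rintro _ ⟨i, hi, rfl⟩
        have hi := Finset.mem_Icc.1 hi
        exact hlift hK0.1 (hall i hi.1 hi.2)
      · filter_upwards [hev] with y hy
        have hd := (mem_dom_LLPO le_rfl).1 hy.2
        obtain ⟨i, hi, hi0⟩ := exists_component_eq_zero (x := tail y) (F := Finset.Icc 1 2)
          (fun i hi => (Finset.mem_Icc.1 hi).1) (hd.trans_lt (by norm_num))
        exact ⟨_, ⟨i, hi, rfl⟩, hlift hy.1 (cons_mem_LLPO.2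
          ⟨hd, (Finset.mem_Icc.1 hi).1, (Finset.mem_Icc.1 hi).2, hi0⟩)⟩
    · refine ⟨{i}, by simp, (Finset.finite_toSet _).image _, ?_, ?_⟩
      · rintro _ ⟨i', hi', rfl⟩
        obtain rfl := Finset.mem_singleton.1 hi'
        exact hlift hK0.1 (hi.self_of_nhds hK0.2)
      · filter_upwards [hev, eventually_nhdsWithin_of_eventually_nhds
          ((continuous_tail.tendsto (K 0)).eventually hi)] with y hy hiy
        exact ⟨_, ⟨i, by simp, rfl⟩, hlift hy.1 (hiy hy.2)⟩
  set C := I.image fun i => H (0, cons 1 (cons i 0)) 0 with hCdef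
  have hC : ∀ c ∈ C, 1 ≤ c := by
    intro c hc
    obtain ⟨i, hi, rfl⟩ := Finset.mem_image.1 hc
    rcases (h 0 h0).2 _ (hF.2.1 _ ⟨i, hi, rfl⟩) with
      ⟨-, -, i', h1, -, hi'⟩ | ⟨n, -, -, -, i', h1, -, -, hi'⟩
    all_goals simpa [hi'] using h1
  -- The left part 0 keeps these inputs in the `LLPOInf 2` branch.
  have ht : Tendsto (fun j => pair 0 (spike C j)) atTop (𝓝[(sumLLPO k).dom] 0) := by
    refine tendsto_nhdsWithin_of_tendsto_nhds_of_eventually_within _ ?_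
      (Eventually.of_forall fun j => spike_mem_dom_sumLLPO hC (Finset.card_image_le.trans hI))
    have h00 : pair 0 0 = 0 := by funext n; simp [pair]
    have := (continuous_pair.tendsto ((0, 0) : Baire × Baire)).comp
      (tendsto_const_nhds.prodMk_nhds (tendsto_spike C))
    simpa [h00, Function.comp_def] using this
  obtain ⟨j, _, ⟨i, hi, rfl⟩, z, hz, hzH⟩ :=
    (ht.eventually (hF.eventually_values hK hH h h0)).exists
  have hmem : z 0 ∈ C := by
    rw [hzH]
    exact Finset.mem_image.2 ⟨i, hi, rfl⟩
  have hzero : component (spike C j) (z 0) = 0 := by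
    rcases hz with ⟨-, -, i', -, hi', rfl⟩ | ⟨n, -, -, -, i', -, -, hi', rfl⟩
    all_goals simpa using hi'
  have := component_spike hmem j
  simp [hzero] at this

/-- Near zero the reduction only uses `R`, and this neighbourhood contains a restricted copy of some
`LLPO n`; hence `k = n + 1` works. -/
theorem exists_not_le_of_le_coprod {R : MultiFun} (hR : sumLLPO 2 ≤ R.coprod (LLPO 2)) :
    ∃ k, 2 ≤ k ∧ ¬ R ≤ sumLLPO k := by
  obtain ⟨K, H, hK, hH, h⟩ := weihrauchLE_iff.1 hR
  have h00 : pair 0 0 = 0 := by funext n; simp [pair]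
  have h0 : (0 : Baire) ∈ (sumLLPO 2).dom := by
    obtain ⟨y, hy⟩ := (mem_dom_LLPOInf (n := 2) (x := 0)).2 (by simp [nonzeroPositions_zero])
    exact ⟨y, Or.inl ⟨rfl, hy⟩⟩
  have hK0 := coprod_LLPO_reduction_apply_zero hK hH h h0
  have hev := eventually_nhdsWithin_iff.1 (eventually_eq_of_continuousOn hK h0 0)
  rw [hK0] at hev
  obtain ⟨n, hn, m, hnm⟩ : ∃ n, 2 ≤ n ∧ ∃ m, ∀ x : Baire, (∀ t < m, x t = 0) →
      pair (Pi.single n 1) x ∈ (sumLLPO 2).dom → K (pair (Pi.single n 1) x) 0 = 0 := by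
    have hev' : ∀ᶠ z in 𝓝 ((0, 0) : Baire × Baire),
        pair z.1 z.2 ∈ (sumLLPO 2).dom → K (pair z.1 z.2) 0 = 0 := by
      have ht := continuous_pair.tendsto ((0, 0) : Baire × Baire)
      rw [h00] at ht
      exact ht.eventually hev
    -- A product neighbourhood separates the two demands: `n` large for the left part, a zero prefix
    -- of length `m` for the right part.
    rw [nhds_prod_eq] at hev'
    obtain ⟨pa, hpa, pb, hpb, hab⟩ := eventually_prod_iff.1 hev'
    have hsingle : Tendsto (fun n => (Pi.single n 1 : Baire)) atTop (𝓝 0) := by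
      refine tendsto_pi_nhds.2 fun t => tendsto_const_nhds.congr' ?_
      filter_upwards [eventually_gt_atTop t] with n hn
      exact (Pi.single_eq_of_ne (M := fun _ : ℕ => ℕ) hn.ne 1).symm
    obtain ⟨n, hn, hn2⟩ := ((hsingle.eventually hpa).and (eventually_ge_atTop 2)).exists
    obtain ⟨_, ⟨x, m, rfl⟩, hx0, hm⟩ :=
      (PiNat.isTopologicalBasis_cylinders fun _ : ℕ => ℕ).mem_nhds_iff.1 hpb
    rw [← PiNat.mem_cylinder_iff_eq.1 hx0] at hm
    exact ⟨n, hn2, m, fun x hx => hab hn (hm fun t ht => hx t ht)⟩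
  refine ⟨n + 1, by omega, fun hle => LLPO_restrictZero_not_le hn m (le_trans ?_ hle)⟩
  have hp := continuous_pair_right (Pi.single n 1)
  have hd : ∀ x ∈ ((LLPO n).restrictZero m).dom, pair (Pi.single n 1) x ∈ (sumLLPO 2).dom := by
    rintro x ⟨y, -, hy⟩
    exact ⟨y, Or.inr ⟨n, hn, by simp, by simpa using hy⟩⟩
  have hz : ∀ x ∈ ((LLPO n).restrictZero m).dom, K (pair (Pi.single n 1) x) 0 = 0 :=
    fun x hx => hnm x hx.choose_spec.1 (hd x hx)
  refine weihrauchLE_iff.2 ⟨fun x => tail (K (pair (Pi.single n 1) x)),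
    fun z => H (pair (Pi.single n 1) z.1, cons 0 z.2), ?_, ?_, ?_⟩
  · exact continuous_tail.comp_continuousOn (hK.comp hp.continuousOn hd)
  · refine hH.comp ((hp.comp continuous_fst).prodMk
      ((continuous_cons 0).comp continuous_snd)).continuousOn ?_
    rintro z ⟨hz1, hz2⟩
    exact ⟨hd _ hz1, Or.inl ⟨hz _ hz1, _, hz2, rfl⟩⟩
  · intro x hx
    refine ⟨?_, fun r hr => ?_⟩
    · rcases mem_dom_coprod (h _ (hd x hx)).1 with h' | h'
      · exact h'.2
      · exact absurd ((hz x hx).symm.trans h'.1) (by simp)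
    · refine ⟨hx.choose_spec.1, ?_⟩
      rcases (h _ (hd x hx)).2 _ (Or.inl ⟨hz x hx, r, hr, rfl⟩) with ⟨hl, -⟩ | ⟨n', -, hl, hr'⟩
      · simp at hl
      · rw [left_pair] at hl
        obtain rfl := eq_of_single_one_apply_ne_zero (n := n') (m := n) (by rw [← hl]; simp)
        simpa using hr'

/-! ### Passage to degrees -/

theorem not_le_all_sumLLPO {a : C0} (ha : deg (sumLLPO 2) ≤ a ⊔ deg (LLPO 2)) :
    ∃ k, 2 ≤ k ∧ ¬ a ≤ deg (sumLLPO k) := by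
  rcases C0_cases a with rfl | ⟨R, rfl⟩
  -- The adjoined top lies below no degree, so any `k ≥ 2` would do.
  · exact ⟨2, le_rfl, fun h => WithTop.coe_ne_top (top_le_iff.1 h)⟩
  · obtain ⟨k, hk, h⟩ := exists_not_le_of_le_coprod (deg_le_deg.1 ha)
    exact ⟨k, hk, fun h' => h (deg_le_deg.1 h')⟩

theorem le_inf_sumLLPO_sup {a : C0} (ha : deg (sumLLPO 2) ≤ a ⊔ deg (LLPO 2)) {k : ℕ}
    (hk : 2 ≤ k) : deg (sumLLPO 2) ≤ (a ⊓ deg (sumLLPO k)) ⊔ deg (LLPO 2) := by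
  have hS : deg (sumLLPO 2) ≤ deg (sumLLPO k) ⊔ deg (LLPO 2) :=
    deg_le_deg.2 (sumLLPO_two_le_coprod hk)
  rcases C0_cases a with rfl | ⟨R, rfl⟩
  · rwa [top_inf_eq]
  · exact deg_le_deg.2 ((le_oplus (deg_le_deg.1 ha) (deg_le_deg.1 hS)).trans
      (oplus_coprod_le _ _ _))

theorem deg_sumLLPO_ne_bot (k : ℕ) : deg (sumLLPO k) ≠ ⊥ :=
  deg_ne_bot.2 ⟨_, spike_mem_dom_sumLLPO (C := ∅) (j := 0) (by simp) (by simp)⟩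

theorem deg_LLPO_two_ne_bot : deg (LLPO 2) ≠ ⊥ :=
  deg_ne_bot.2 ⟨0, (mem_dom_LLPO le_rfl).2 (by simp [nonzeroPositions_zero])⟩

/-- Minimality against the smaller solution `R ⊓ deg (sumLLPO k)` forces `R ≤ deg (sumLLPO k)` for a
`k` where this fails. -/
theorem not_minimal_C0 (R : C0) :
    ¬ Minimal (fun S : C0 => deg (sumLLPO 2) ≤ S ⊔ deg (LLPO 2)) R := by
  intro hR
  obtain ⟨k, hk, h⟩ := not_le_all_sumLLPO hR.1
  exact h ((hR.2 (le_inf_sumLLPO_sup hR.1 hk) inf_le_left).trans inf_le_right)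

theorem not_minimal_C (R : C) :
    ¬ Minimal (fun S : C => deg (sumLLPO 2) ≤ (S : C0) ⊔ deg (LLPO 2)) R := by
  intro hR
  obtain ⟨k, hk, h⟩ := not_le_all_sumLLPO hR.1
  let T : C := ⟨deg (sumLLPO k), deg_sumLLPO_ne_bot k⟩
  have hle : R ≤ R ⊓ T := hR.2 (le_inf_sumLLPO_sup hR.1 hk) inf_le_left
  exact h (hle.trans (inf_le_right : R ⊓ T ≤ T))

end ContWeihrauch

theorem theorem26 :
    ¬ ContWeihrauch.IsBrouwerAlgebra ContWeihrauch.C0 ∧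
    ¬ ContWeihrauch.IsBrouwerAlgebra ContWeihrauch.C ∧
    (∀ R : ContWeihrauch.C0, ¬ Minimal (fun S : ContWeihrauch.C0 =>
      ContWeihrauch.deg (ContWeihrauch.sumLLPO 2) ≤
        S ⊔ ContWeihrauch.deg (ContWeihrauch.LLPO 2)) R) ∧
    (∀ R : ContWeihrauch.C, ¬ Minimal (fun S : ContWeihrauch.C =>
      ContWeihrauch.deg (ContWeihrauch.sumLLPO 2) ≤
        (S : ContWeihrauch.C0) ⊔ ContWeihrauch.deg (ContWeihrauch.LLPO 2)) R) ∧
    (∀ k : ℕ, 2 ≤ k → ContWeihrauch.deg (ContWeihrauch.sumLLPO (k + 1)) <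
      ContWeihrauch.deg (ContWeihrauch.sumLLPO k)) := by
  open ContWeihrauch in
  refine ⟨fun h => ?_, fun h => ?_, not_minimal_C0, not_minimal_C, fun k hk => ?_⟩
  -- A least solution would be minimal.
  · obtain ⟨c, hc⟩ := h (deg (LLPO 2)) (deg (sumLLPO 2))
    exact not_minimal_C0 c ⟨hc.1, fun _ hb _ => hc.2 hb⟩
  · obtain ⟨c, hc⟩ := h ⟨deg (LLPO 2), deg_LLPO_two_ne_bot⟩
      ⟨deg (sumLLPO 2), deg_sumLLPO_ne_bot 2⟩
    exact not_minimal_C c ⟨hc.1, fun _ hb _ => hc.2 hb⟩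
  · exact lt_of_le_not_ge (deg_le_deg.2 (sumLLPO_succ_le k))
      fun h => sumLLPO_not_le_succ hk (deg_le_deg.1 h)
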